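/- Let $\Omega\subset\mathbb R^2$ be a domain, i.e. a bounded connected open set with Lipschitz-continuous boundary, lying locally on one side of its boundary. Let $T>0$, $2.8\le p\le 5$, $p'=p/(p-1)$, $\alpha=\frac{3p-1}{2p}$ (so $1<\alpha<2$), $\kappa>0$, let $N\ge1$ be an integer and put $\ell=T/N$. Let $\mu:\overline\Omega\to\mathbb R$ be measurable with $\mu_1\le\mu(x)\le\mu_2$ for all $x\in\overline\Omega$, for some constants $\mu_1,\mu_2>0$, and let $\tilde a\in W^{1,p}(0,T;\mathcal C^0(\overline\Omega))$. Write $\{s\}^-=\frac{|s|-s}{2}$ for the negative part of $s\in\mathbb R$, and $K=\{v\in W_0^{1,p}(\Omega):\ v\ge0\}$. For $0\le n\le N-1$ and given $u^n\in W_0^{1,p}(\Omega)$, let $\mathcal P_\kappa^{n+1}$ be the problem of finding $u^{n+1}\in W_0^{1,p}(\Omega)$ such that $$\frac1\ell\left\{|u^{n+1}|^{\alpha-2}u^{n+1}-|u^n|^{\alpha-2}u^n\right\}-\nabla\cdot\left(\mu|\nabla u^{n+1}|^{p-2}\nabla u^{n+1}\right)-\frac{\{u^{n+1}\}^-}{\kappa}=\frac1\ell\int_{n\ell}^{(n+1)\ell}\tilde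 a(t)\,dt\quad\text{in }W^{-1,p'}(\Omega)=\left(W_0^{1,p}(\Omega)\right)^*,$$ that is, for all $v\in W_0^{1,p}(\Omega)$, $$\frac1\ell\int_\Omega\left(|u^{n+1}|^{\alpha-2}u^{n+1}-|u^n|^{\alpha-2}u^n\right)v\,dx+\int_\Omega\mu|\nabla u^{n+1}|^{p-2}\nabla u^{n+1}\cdot\nabla v\,dx-\frac1\kappa\int_\Omega\{u^{n+1}\}^-v\,dx=\int_\Omega\left(\frac1\ell\int_{n\ell}^{(n+1)\ell}\tilde a(t)\,dt\right)v\,dx .$$ Then for every $0\le n\le N-1$ and every $u^n\in W_0^{1,p}(\Omega)$, problem $\mathcal P_\kappa^{n+1}$ has exactly one solution $u^{n+1}\in W_0^{1,p}(\Omega)$. In particular, for every $u_0\in K$ there is exactly one sequence $(u^0,u^1,\dots,u^N)$ in $W_0^{1,p}(\Omega)$ with $u^0=u_0$ such that $u^{n+1}$ solves $\mathcal P_\kappa^{n+1}$ for the given $u^n$, for every $0\le n\le N-1$. -/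

import Mathlib

open MeasureTheory Set Filter Topology TopologicalSpace
open scoped NNReal ENNReal Distributions BoundedContinuousFunction

namespace IceSheet

noncomputable section

/-- The Euclidean plane. -/
abbrev Plane : Type := EuclideanSpace ℝ (Fin 2)

/-- A domain in the plane: a bounded connected open set whose boundary is Lipschitz-continuous,
the set being locally on one side of its boundary (near each boundary point, in suitable
orthonormal coordinates, it is the strict epigraph of a Lipschitz function). -/
structure IsLipschitzDomain (Ω : Opens Plane) : Prop where
  isBounded : Bornology.IsBounded (Ω : Set Plane)
  isConnected : IsConnected (Ω : Set Plane)
  lipschitz_boundary : ∀ x ∈ frontier (Ω : Set Plane),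
    ∃ (r : ℝ) (e : Plane ≃ₗᵢ[ℝ] Plane) (K : ℝ≥0) (γ : ℝ → ℝ),
      0 < r ∧ LipschitzWith K γ ∧ ∀ y ∈ Metric.ball x r, y ∈ Ω ↔ γ (e y 0) < e y 1

/-- `G` is a weak gradient of `u` in `Ω`. -/
def HasWeakGradient (Ω : Opens Plane) (u : Plane → ℝ) (G : Plane → Plane) : Prop :=
  ∀ φ : 𝓓(Ω, ℝ), ∫ x in Ω, u x • gradient φ x = -∫ x in Ω, φ x • G x

lemma continuous_gradient {Ω : Opens Plane} (φ : 𝓓(Ω, ℝ)) : Continuous (gradient φ) :=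
  (InnerProductSpace.toDual ℝ Plane).symm.continuous.comp
    (φ.contDiff.continuous_fderiv (by simp))

lemma hasCompactSupport_gradient {Ω : Opens Plane} (φ : 𝓓(Ω, ℝ)) :
    HasCompactSupport (gradient φ) :=
  (φ.hasCompactSupport.fderiv ℝ).comp_left
    (g := (InnerProductSpace.toDual ℝ Plane).symm) (map_zero _)

section

variable (Ω : Opens Plane) (q : ℝ≥0∞) [hq : Fact (1 ≤ q)]

/-- The Lebesgue space `L^q(Ω)`. -/
abbrev LpScalar : Type := Lp ℝ q (volume.restrict (Ω : Set Plane))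

/-- The Lebesgue space `L^q(Ω; ℝ²)`. -/
abbrev LpVector : Type := Lp Plane q (volume.restrict (Ω : Set Plane))

variable {Ω q}

lemma integrable_smul_gradient (u : LpScalar Ω q) (φ : 𝓓(Ω, ℝ)) :
    Integrable (fun x => u x • gradient φ x) (volume.restrict (Ω : Set Plane)) :=
  ((Lp.memLp u).locallyIntegrable hq.out).integrable_smul_right_of_hasCompactSupport
    (continuous_gradient φ) (hasCompactSupport_gradient φ)

lemma integrable_testFunction_smul (G : LpVector Ω q) (φ : 𝓓(Ω, ℝ)) :
    Integrable (fun x => φ x • G x) (volume.restrict (Ω : Set Plane)) :=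
  ((Lp.memLp G).locallyIntegrable hq.out).integrable_smul_left_of_hasCompactSupport
    φ.continuous φ.hasCompactSupport

variable (Ω q)

/-- The Sobolev space `W^{1,q}(Ω)`: the functions `u ∈ L^q(Ω)` with a weak gradient in `L^q(Ω; ℝ²)`.
An element is stored as the pair `(u, ∇u)` (the second component is determined by the first,
see `SobolevW.ext`), and the norm is the norm of that pair, a standard norm of `W^{1,q}(Ω)`
up to equivalence. -/
def SobolevW : Submodule ℝ (LpScalar Ω q × LpVector Ω q) where
  carrier := {w | HasWeakGradient Ω w.1 w.2}
  zero_mem' := by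
    intro φ
    have h1 : ∀ᵐ x ∂(volume.restrict (Ω : Set Plane)),
        ((0 : LpScalar Ω q) x) • gradient φ x = 0 := by
      filter_upwards [Lp.coeFn_zero ℝ q (volume.restrict (Ω : Set Plane))] with x hx
      rw [hx, Pi.zero_apply, zero_smul]
    have h2 : ∀ᵐ x ∂(volume.restrict (Ω : Set Plane)), φ x • ((0 : LpVector Ω q) x) = 0 := by
      filter_upwards [Lp.coeFn_zero Plane q (volume.restrict (Ω : Set Plane))] with x hx
      rw [hx, Pi.zero_apply, smul_zero]
    simp only [Prod.fst_zero, Prod.snd_zero]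
    rw [integral_congr_ae h1, integral_congr_ae h2]
    simp
  add_mem' := by
    intro w w' hw hw' φ
    have h1 : ∀ᵐ x ∂(volume.restrict (Ω : Set Plane)),
        ((w.1 + w'.1 : LpScalar Ω q) x) • gradient φ x
          = w.1 x • gradient φ x + w'.1 x • gradient φ x := by
      filter_upwards [Lp.coeFn_add w.1 w'.1] with x hx
      rw [hx, Pi.add_apply, add_smul]
    have h2 : ∀ᵐ x ∂(volume.restrict (Ω : Set Plane)),
        φ x • ((w.2 + w'.2 : LpVector Ω q) x) = φ x • w.2 x + φ x • w'.2 x := by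
      filter_upwards [Lp.coeFn_add w.2 w'.2] with x hx
      rw [hx, Pi.add_apply, smul_add]
    simp only [Prod.fst_add, Prod.snd_add]
    rw [integral_congr_ae h1, integral_congr_ae h2,
      integral_add (integrable_smul_gradient _ φ) (integrable_smul_gradient _ φ),
      integral_add (integrable_testFunction_smul _ φ) (integrable_testFunction_smul _ φ),
      hw φ, hw' φ, neg_add]
  smul_mem' := by
    intro c w hw φ
    have h1 : ∀ᵐ x ∂(volume.restrict (Ω : Set Plane)),
        ((c • w.1 : LpScalar Ω q) x) • gradient φ x = c • (w.1 x • gradient φ x) := by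
      filter_upwards [Lp.coeFn_smul c w.1] with x hx
      rw [hx, Pi.smul_apply, smul_eq_mul, mul_smul]
    have h2 : ∀ᵐ x ∂(volume.restrict (Ω : Set Plane)),
        φ x • ((c • w.2 : LpVector Ω q) x) = c • (φ x • w.2 x) := by
      filter_upwards [Lp.coeFn_smul c w.2] with x hx
      rw [hx, Pi.smul_apply, smul_comm c (φ x)]
    simp only [Prod.smul_fst, Prod.smul_snd]
    rw [integral_congr_ae h1, integral_congr_ae h2, integral_smul, integral_smul, hw φ, smul_neg]

variable {Ω q}

/-- An element of `W^{1,q}(Ω)` is determined by its underlying `L^q` function. -/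
lemma SobolevW.ext {w w' : SobolevW Ω q} (h : w.1.1 = w'.1.1) : w = w' := by
  refine Subtype.ext (Prod.ext h ?_)
  apply Lp.ext
  have hloc : ∀ G : LpVector Ω q, LocallyIntegrableOn G (Ω : Set Plane) volume := fun G =>
    locallyIntegrableOn_of_locallyIntegrable_restrict
      ((Lp.memLp G).locallyIntegrable Fact.out)
  have key := Ω.isOpen.ae_eq_zero_of_integral_contDiff_smul_eq_zero
    (f := fun x => w.1.2 x - w'.1.2 x) ((hloc _).sub (hloc _)) ?_
  · rw [Filter.EventuallyEq, ae_restrict_iff' Ω.isOpen.measurableSet]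
    filter_upwards [key] with x hx hxΩ
    exact sub_eq_zero.mp (hx hxΩ)
  · intro g g1 g2 g3
    let φ : 𝓓(Ω, ℝ) := ⟨g, g1, g2, g3⟩
    have e1 : ∫ x in Ω, φ x • w.1.2 x = ∫ x in Ω, φ x • w'.1.2 x := by
      have a := w.2 φ
      have b := w'.2 φ
      rw [h] at a
      exact neg_injective (a.symm.trans b)
    have e2 : ∫ x in Ω, φ x • (w.1.2 x - w'.1.2 x) = 0 := by
      simp only [smul_sub]
      rw [integral_sub (integrable_testFunction_smul _ φ) (integrable_testFunction_smul _ φ), e1,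
        sub_self]
    rw [← e2, setIntegral_eq_integral_of_forall_compl_eq_zero]
    · rfl
    · intro x hx
      have : φ x = 0 := image_eq_zero_of_notMem_tsupport fun h' => hx (g3 h')
      simp [this]

variable (Ω q)

/-- The test functions `𝓓(Ω)`, as a subspace of `W^{1,q}(Ω)`. -/
def testSubmodule : Submodule ℝ (SobolevW Ω q) where
  carrier := {w | ∃ φ : 𝓓(Ω, ℝ), w.1.1 =ᵐ[volume.restrict (Ω : Set Plane)] φ ∧
    w.1.2 =ᵐ[volume.restrict (Ω : Set Plane)] gradient φ}
  zero_mem' := by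
    refine ⟨0, ?_, ?_⟩
    · exact Lp.coeFn_zero ℝ q _
    · refine (Lp.coeFn_zero Plane q _).trans (Eventually.of_forall fun x => ?_)
      simp [gradient]
  add_mem' := by
    rintro w w' ⟨φ, h1, h2⟩ ⟨ψ, h3, h4⟩
    refine ⟨φ + ψ, ?_, ?_⟩
    · filter_upwards [Lp.coeFn_add w.1.1 w'.1.1, h1, h3] with x hx a b
      simpa [a, b] using hx
    · filter_upwards [Lp.coeFn_add w.1.2 w'.1.2, h2, h4] with x hx a b
      have e : gradient (⇑(φ + ψ)) x = gradient φ x + gradient ψ x := by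
        have := fderiv_add (𝕜 := ℝ) (x := x) (φ.contDiff.differentiable (by simp) x)
          (ψ.contDiff.differentiable (by simp) x)
        simp only [gradient, FunLike.coe_add, this, map_add]
      rw [e, ← a, ← b]
      exact hx
  smul_mem' := by
    rintro c w ⟨φ, h1, h2⟩
    refine ⟨c • φ, ?_, ?_⟩
    · filter_upwards [Lp.coeFn_smul c w.1.1, h1] with x hx a
      simpa [a] using hx
    · filter_upwards [Lp.coeFn_smul c w.1.2, h2] with x hx a
      have e : gradient (⇑(c • φ)) x = c • gradient φ x := by
        have := fderiv_const_smul (𝕜 := ℝ) (x := x) (φ.contDiff.differentiable (by simp) x) c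
        simp only [gradient, FunLike.coe_smul, this, map_smul]
      rw [e, ← a]
      exact hx

/-- The Sobolev space `W₀^{1,q}(Ω)`: the closure of `𝓓(Ω)` in `W^{1,q}(Ω)`. -/
def SobolevW0 : Submodule ℝ (SobolevW Ω q) := (testSubmodule Ω q).topologicalClosure

variable {Ω q}

/-- The function underlying an element of `W₀^{1,q}(Ω)`. -/
def toFn (u : SobolevW0 Ω q) : Plane → ℝ := u.1.1.1

/-- The weak gradient of an element of `W₀^{1,q}(Ω)`. -/
def weakGrad (u : SobolevW0 Ω q) : Plane → Plane := u.1.1.2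

variable (Ω q)

/-- The set `K` of the nonnegative elements of `W₀^{1,q}(Ω)`. -/
def nonnegCone : Set (SobolevW0 Ω q) :=
  {u | ∀ᵐ x ∂(volume.restrict (Ω : Set Plane)), 0 ≤ toFn u x}

end

/-- The space `C⁰(closure Ω)` with the sup norm (for bounded `Ω` every continuous function on
`closure Ω` is bounded). -/
abbrev ContClosure (Ω : Opens Plane) : Type := (closure (Ω : Set Plane)) →ᵇ ℝ

/-- `f ∈ W^{1,q}(0,T;X)`: both `f` and a weak derivative of `f` belong to `L^q(0,T;X)`. -/
def MemTimeSobolev {X : Type*} [NormedAddCommGroup X] [NormedSpace ℝ X]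
    (q : ℝ≥0∞) (T : ℝ) (f : ℝ → X) : Prop :=
  MemLp f q (volume.restrict (Ioo 0 T)) ∧
    ∃ f' : ℝ → X, MemLp f' q (volume.restrict (Ioo 0 T)) ∧
      ∀ φ : 𝓓((⟨Ioo 0 T, isOpen_Ioo⟩ : Opens ℝ), ℝ),
        ∫ t in Ioo 0 T, deriv φ t • f t = -∫ t in Ioo 0 T, φ t • f' t

/-- The exponent `α = (3p - 1) / (2p)`. -/
def alpha (p : ℝ) : ℝ := (3 * p - 1) / (2 * p)

/-- The negative part `{s}⁻ = (|s| - s) / 2` of a real number. -/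
def negativePart (s : ℝ) : ℝ := (|s| - s) / 2

/-- The time average `(1/ℓ) ∫_{nℓ}^{(n+1)ℓ} ã(t) dt`, a Bochner integral in `C⁰(closure Ω)`. -/
def sourceMean {Ω : Opens Plane} (a : ℝ → ContClosure Ω) (ℓ : ℝ) (n : ℕ) : ContClosure Ω :=
  (1 / ℓ) • ∫ t in (n * ℓ)..((n + 1) * ℓ), a t

/-- A continuous function on `closure Ω`, extended by zero to the plane. -/
def extendZero {Ω : Opens Plane} (f : ContClosure Ω) : Plane → ℝ :=
  Function.extend Subtype.val f 0

/-- `uNext` solves the semi-discrete penalized problem with index `n + 1` for the previous iterate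
`uPrev`: the identity
`(1/ℓ) (|uNext|^(α-2) uNext - |uPrev|^(α-2) uPrev) - div (μ |∇uNext|^(p-2) ∇uNext) - {uNext}⁻ / κ
  = (1/ℓ) ∫_{nℓ}^{(n+1)ℓ} ã(t) dt`
holds in the dual of `W₀^{1,p}(Ω)`, that is, when evaluated at every `v` in that space. -/
def IsStepSolution {Ω : Opens Plane} {p : ℝ} [Fact (1 ≤ ENNReal.ofReal p)]
    (κ ℓ : ℝ) (μ : Plane → ℝ) (a : ℝ → ContClosure Ω) (n : ℕ)
    (uPrev uNext : SobolevW0 Ω (ENNReal.ofReal p)) : Prop :=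
  ∀ v : SobolevW0 Ω (ENNReal.ofReal p),
    (1 / ℓ) * (∫ x in Ω, (|toFn uNext x| ^ (alpha p - 2) * toFn uNext x
        - |toFn uPrev x| ^ (alpha p - 2) * toFn uPrev x) * toFn v x)
      + (∫ x in Ω, μ x * inner ℝ (‖weakGrad uNext x‖ ^ (p - 2) • weakGrad uNext x) (weakGrad v x))
      - (1 / κ) * (∫ x in Ω, negativePart (toFn uNext x) * toFn v x)
    = ∫ x in Ω, extendZero (sourceMean a ℓ n) x * toFn v x

end

end IceSheet

open IceSheet

/-! The step equation is the Euler–Lagrange equation of J(u) = (1/(ℓα)) ∫ |u|^α + (1/p) ∫ μ|∇u|^p +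
(1/(2κ)) ∫ ({u}⁻)² - F(u), where F collects the terms known from the previous step: |uⁿ|^(α-2) uⁿ /
ℓ and the averaged source. The first and third integrals are convex. Since p ≥ 2, Clarkson's
inequality makes the second one p-uniformly convex in ∇u, and Poincaré's inequality transfers this
to the full norm. With A the formal derivative of J, this yields J(u) + A(u)(w - u) + c‖w - u‖^p ≤
J(w).

This one inequality drives `existsUnique_zero_of_uniformlyConvex`: J is bounded below, minimizing
sequences are Cauchy, the limit is a minimizer, and A has at most one zero. Neither weak compactness
nor differentiability of J is needed; hemicontinuity of A along rays suffices. The analytic input is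
`powerFlux_uniform_subgradient`, `ConvexPotential.exists_dual` and `exists_poincare`. The sequence
of iterates then follows by recursion on n. -/

namespace IceSheet

/-! ### Minimization of uniformly convex functionals -/

section AbstractMinimization

variable {X : Type*} [NormedAddCommGroup X] [NormedSpace ℝ X]

lemma exists_lower_bound_mul_rpow_sub_mul {c p : ℝ} (hc : 0 < c) (hp : 1 < p) (M : ℝ)
    (hM : 0 ≤ M) : ∃ b : ℝ, ∀ x : ℝ, 0 ≤ x → b ≤ c * x ^ p - M * x := by
  -- R is the point where c x^(p-1) = M: beyond it the expression is nonnegative, before it the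
  -- linear term is at most M R.
  set R : ℝ := (M / c) ^ (1 / (p - 1)) with hR
  have hMc : 0 ≤ M / c := by positivity
  have hR0 : 0 ≤ R := by positivity
  refine ⟨-(M * R), fun x hx => ?_⟩
  rcases le_total x R with h | h
  · have := mul_le_mul_of_nonneg_left h hM
    have : 0 ≤ c * x ^ p := by positivity
    linarith
  · rcases hx.eq_or_lt with rfl | hx'
    · have : R = 0 := le_antisymm h hR0
      simp [this, Real.zero_rpow (by linarith : p ≠ 0)]
    have h1 : M / c ≤ x ^ (p - 1) := by
      have := Real.rpow_le_rpow hR0 h (by linarith : 0 ≤ p - 1)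
      rwa [hR, ← Real.rpow_mul hMc, one_div_mul_cancel (by linarith), Real.rpow_one] at this
    have h2 : x ^ p = x ^ (p - 1) * x := by
      rw [← Real.rpow_add_one hx'.ne']; ring_nf
    have h3 : M ≤ c * x ^ (p - 1) := by
      rw [div_le_iff₀ hc] at h1; linarith
    have h4 : M * x ≤ c * x ^ p := by
      rw [h2, ← mul_assoc]; exact mul_le_mul_of_nonneg_right h3 hx
    have : 0 ≤ M * R := by positivity
    linarith

/-- The derivative `A` of a `p`-uniformly convex functional `J` on a Banach space has exactly one
zero. -/
theorem existsUnique_zero_of_uniformlyConvex [CompleteSpace X] {J : X → ℝ} {A : X → X →L[ℝ] ℝ}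
    {c p : ℝ} (hc : 0 < c) (hp : 1 < p)
    (hJ : ∀ u w, J u + A u (w - u) + c * ‖w - u‖ ^ p ≤ J w)
    (hA : ∀ u v, Tendsto (fun t : ℝ => A (u + t • v) v) (𝓝[>] 0) (𝓝 (A u v))) :
    ∃! u, A u = 0 := by
  have hp0 : p ≠ 0 := by linarith
  have hbdd : BddBelow (range J) := by
    obtain ⟨b, hb⟩ := exists_lower_bound_mul_rpow_sub_mul hc hp ‖A 0‖ (norm_nonneg _)
    refine ⟨J 0 + b, ?_⟩
    rintro _ ⟨w, rfl⟩
    have h1 := hJ 0 w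
    have h2 := hb ‖w‖ (norm_nonneg _)
    have h3 := (abs_le.1 ((A 0).le_opNorm w)).1
    rw [sub_zero] at h1
    linarith
  set m := ⨅ u, J u with hm
  have hmle : ∀ u, m ≤ J u := fun u => ciInf_le hbdd u
  have hex : ∀ n : ℕ, ∃ u, J u < m + 1 / ((n : ℝ) + 1) := fun n =>
    exists_lt_of_ciInf_lt (lt_add_of_pos_right _ (by positivity))
  choose s hs using hex
  -- The inequality based at the midpoint z is applied towards u and towards w; the two linear terms
  -- cancel in the sum, and J z ≥ m.
  have hmid : ∀ u w, 2 * c * ‖(1 / 2 : ℝ) • (u - w)‖ ^ p ≤ J u + J w - 2 * m := by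
    intro u w
    set z := (1 / 2 : ℝ) • (u + w)
    have e1 : u - z = (1 / 2 : ℝ) • (u - w) := by simp only [z]; module
    have e2 : w - z = -((1 / 2 : ℝ) • (u - w)) := by simp only [z]; module
    have h1 := hJ z u
    have h2 := hJ z w
    rw [e1] at h1
    rw [e2, norm_neg, map_neg] at h2
    have := hmle z
    linarith
  have hcauchy : CauchySeq s := by
    rw [Metric.cauchySeq_iff']
    intro ε hε
    obtain ⟨n, hn⟩ := exists_nat_one_div_lt (show 0 < c * (ε / 2) ^ p by positivity)
    refine ⟨n, fun k hk => ?_⟩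
    have h1 := hmid (s k) (s n)
    have h2 := hs k
    have h3 := hs n
    have h4 : 1 / ((k : ℝ) + 1) ≤ 1 / ((n : ℝ) + 1) := by
      apply one_div_le_one_div_of_le (by positivity)
      exact_mod_cast Nat.succ_le_succ hk
    have h5 : ‖(1 / 2 : ℝ) • (s k - s n)‖ ^ p < (ε / 2) ^ p := by
      refine lt_of_mul_lt_mul_left (a := 2 * c) ?_ (by positivity)
      linarith
    have h6 := (Real.rpow_lt_rpow_iff (norm_nonneg _) (by positivity) (by linarith)).1 h5
    rw [norm_smul, Real.norm_of_nonneg (by norm_num)] at h6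
    rw [dist_eq_norm]
    linarith
  obtain ⟨u, hu⟩ := cauchySeq_tendsto_of_complete hcauchy
  -- The tangent functional at u stands in for lower semicontinuity of J: J u ≤ J (s n) - A u (s n -
  -- u), and the right side is below a sequence tending to m.
  have hlim : Tendsto (fun n : ℕ => m + 1 / ((n : ℝ) + 1) - A u (s n - u)) atTop (𝓝 m) := by
    have h1 : Tendsto (fun n => A u (s n - u)) atTop (𝓝 (A u (u - u))) :=
      ((A u).continuous.tendsto _).comp (hu.sub_const u)
    rw [sub_self, map_zero] at h1
    simpa using (tendsto_one_div_add_atTop_nhds_zero_nat.const_add m).sub h1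
  have hmin : J u ≤ m := by
    refine ge_of_tendsto' hlim fun n => ?_
    have h1 := hJ u (s n)
    have h2 := hs n
    have : 0 ≤ c * ‖s n - u‖ ^ p := by positivity
    linarith
  -- The inequality is based at u + t v rather than at u. Minimality of u then gives A (u + t v) v ≥
  -- 0 for t > 0, and hemicontinuity passes to t = 0.
  have hnonneg : ∀ v, 0 ≤ A u v := by
    intro v
    refine ge_of_tendsto (hA u v) ?_
    filter_upwards [self_mem_nhdsWithin] with t ht
    have ht' : (0 : ℝ) < t := ht
    have h1 := hJ (u + t • v) u
    have e : u - (u + t • v) = -(t • v) := by abel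
    rw [e, map_neg, map_smul, smul_eq_mul] at h1
    have h2 : 0 ≤ c * ‖-(t • v)‖ ^ p := by positivity
    have h3 := hmle (u + t • v)
    have h4 : 0 ≤ t * A (u + t • v) v := by linarith
    exact nonneg_of_mul_nonneg_right h4 ht'
  refine ⟨u, ?_, ?_⟩
  · ext v
    have h1 := hnonneg v
    have h2 := hnonneg (-v)
    rw [map_neg] at h2
    simp only [zero_apply]
    linarith
  -- A zero w of A satisfies J w + c‖u - w‖^p ≤ J u ≤ m ≤ J w.
  · intro w hw
    have h1 := hJ w u
    have h2 := hmle w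
    have hw' : A w = 0 := hw
    rw [hw', zero_apply] at h1
    have h3 : c * ‖u - w‖ ^ p ≤ 0 := by linarith
    have h4 : ‖u - w‖ ^ p = 0 :=
      le_antisymm (nonpos_of_mul_nonpos_right h3 hc) (by positivity)
    rw [Real.rpow_eq_zero (norm_nonneg _) hp0, norm_eq_zero, sub_eq_zero] at h4
    exact h4.symm

end AbstractMinimization

/-! ### Pointwise convexity of the power and penalty potentials -/

section Potentials

variable {E : Type*} [NormedAddCommGroup E] [InnerProductSpace ℝ E]

/-- A convex potential `B` with gradient `b` of growth `p - 1`, where `c` is the modulus of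
`p`-uniform convexity. -/
structure ConvexPotential (p c : ℝ) (B : E → ℝ) (b : E → E) : Prop where
  continuous_pot : Continuous B
  continuous_flux : Continuous b
  abs_pot_le : ∀ ξ, |B ξ| ≤ (1 + ‖ξ‖) ^ p
  norm_flux_le : ∀ ξ, ‖b ξ‖ ≤ (1 + ‖ξ‖) ^ (p - 1)
  subgradient : ∀ ξ η, B ξ + inner ℝ (b ξ) (η - ξ) + c * ‖η - ξ‖ ^ p ≤ B η

/-- The gradient of `ξ ↦ ‖ξ‖ ^ q / q`. -/
noncomputable def powerFlux (q : ℝ) (ξ : E) : E := ‖ξ‖ ^ (q - 2) • ξ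

lemma norm_powerFlux {q : ℝ} (hq : 1 < q) (ξ : E) : ‖powerFlux q ξ‖ = ‖ξ‖ ^ (q - 1) := by
  rcases eq_or_ne ξ 0 with rfl | h
  · simp [powerFlux, Real.zero_rpow (by linarith : q - 1 ≠ 0)]
  · have h' : ‖ξ‖ ≠ 0 := norm_ne_zero_iff.2 h
    rw [powerFlux, norm_smul, Real.norm_of_nonneg (by positivity), ← Real.rpow_add_one h']
    ring_nf

lemma inner_powerFlux_self {q : ℝ} (hq : 1 < q) (ξ : E) :
    inner ℝ (powerFlux q ξ) ξ = ‖ξ‖ ^ q := by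
  rcases eq_or_ne ξ 0 with rfl | h
  · simp [Real.zero_rpow (by linarith : q ≠ 0)]
  · have h' : 0 < ‖ξ‖ := norm_pos_iff.2 h
    rw [powerFlux, real_inner_smul_left, real_inner_self_eq_norm_sq, ← Real.rpow_natCast,
      ← Real.rpow_add h']
    norm_num

lemma continuous_powerFlux {q : ℝ} (hq : 1 < q) : Continuous (powerFlux q : E → E) := by
  rw [continuous_iff_continuousAt]
  intro ξ
  rcases eq_or_ne ξ 0 with rfl | h
  · have h0 : powerFlux q (0 : E) = 0 := by simp [powerFlux]
    rw [ContinuousAt, h0, tendsto_zero_iff_norm_tendsto_zero]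
    simp only [norm_powerFlux hq]
    have : Continuous fun ξ : E => ‖ξ‖ ^ (q - 1) :=
      continuous_norm.rpow_const fun _ => Or.inr (by linarith)
    simpa [Real.zero_rpow (by linarith : q - 1 ≠ 0)] using this.tendsto 0
  · exact (continuous_norm.continuousAt.rpow_const (Or.inl (norm_ne_zero_iff.2 h))).smul
      continuousAt_id

/-- Young's inequality with exponents q and q/(q-1), applied to ‖η‖ and ‖ξ‖^(q-1) after
Cauchy–Schwarz. -/
lemma powerFlux_subgradient {q : ℝ} (hq : 1 < q) (ξ η : E) :
    ‖ξ‖ ^ q / q + inner ℝ (powerFlux q ξ) (η - ξ) ≤ ‖η‖ ^ q / q := by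
  have hq0 : q ≠ 0 := by linarith
  have hc : q.HolderConjugate (q / (q - 1)) := Real.HolderConjugate.conjExponent hq
  have h1 : inner ℝ (powerFlux q ξ) η ≤ ‖η‖ * ‖ξ‖ ^ (q - 1) := by
    rw [mul_comm, ← norm_powerFlux hq]; exact real_inner_le_norm _ _
  have h2 := Real.young_inequality_of_nonneg (norm_nonneg η)
    (by positivity : 0 ≤ ‖ξ‖ ^ (q - 1)) hc
  rw [← Real.rpow_mul (norm_nonneg _), mul_div_cancel₀ _ (by linarith : q - 1 ≠ 0)] at h2
  rw [inner_sub_right, inner_powerFlux_self hq]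
  have h3 : ‖ξ‖ ^ q / (q / (q - 1)) = ‖ξ‖ ^ q - ‖ξ‖ ^ q / q := by
    field_simp
  linarith

/-- Superadditivity of s ↦ s^(p/2) on the nonnegative reals, which needs p/2 ≥ 1. -/
lemma add_rpow_le_rpow_sq_add_sq {p x y : ℝ} (hp : 2 ≤ p) (hx : 0 ≤ x) (hy : 0 ≤ y) :
    x ^ p + y ^ p ≤ (x ^ 2 + y ^ 2) ^ (p / 2) := by
  have e : ∀ z : ℝ, 0 ≤ z → z ^ p = (z ^ 2) ^ (p / 2) := fun z hz => by
    rw [← Real.rpow_natCast, ← Real.rpow_mul hz]; congr 1; push_cast; ring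
  rw [e x hx, e y hy]
  exact Real.add_rpow_le_rpow_add (by positivity) (by positivity) (by linarith)

/-- Clarkson's inequality in an inner product space. -/
lemma norm_rpow_clarkson {p : ℝ} (hp : 2 ≤ p) (ξ η : E) :
    ‖(1 / 2 : ℝ) • (ξ + η)‖ ^ p + ‖(1 / 2 : ℝ) • (η - ξ)‖ ^ p ≤ (‖ξ‖ ^ p + ‖η‖ ^ p) / 2 := by
  refine (add_rpow_le_rpow_sq_add_sq hp (norm_nonneg _) (norm_nonneg _)).trans ?_
  have e : ∀ z : ℝ, 0 ≤ z → z ^ p = (z ^ 2) ^ (p / 2) := fun z hz => by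
    rw [← Real.rpow_natCast, ← Real.rpow_mul hz]; congr 1; push_cast; ring
  have h1 : ‖(1 / 2 : ℝ) • (ξ + η)‖ ^ 2 + ‖(1 / 2 : ℝ) • (η - ξ)‖ ^ 2
      = 1 / 2 * ‖ξ‖ ^ 2 + 1 / 2 * ‖η‖ ^ 2 := by
    have := parallelogram_law_with_norm ℝ η ξ
    rw [norm_smul, norm_smul, Real.norm_of_nonneg (by norm_num), add_comm ξ η]
    nlinarith
  rw [h1]
  have h2 := (convexOn_rpow (by linarith : 1 ≤ p / 2)).2
    (mem_Ici.2 (sq_nonneg ‖ξ‖)) (mem_Ici.2 (sq_nonneg ‖η‖))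
    (by norm_num : (0 : ℝ) ≤ 1 / 2) (by norm_num : (0 : ℝ) ≤ 1 / 2) (by norm_num)
  simp only [smul_eq_mul] at h2
  rw [← e _ (norm_nonneg _), ← e _ (norm_nonneg _)] at h2
  linarith

/-- The plain subgradient inequality is tested at the midpoint of ξ and η, where Clarkson's
inequality leaves the gain ‖(η - ξ)/2‖^p. Doubling produces the constant 2 (1/2)^p / p. -/
lemma powerFlux_uniform_subgradient {p : ℝ} (hp : 2 ≤ p) (ξ η : E) :
    ‖ξ‖ ^ p / p + inner ℝ (powerFlux p ξ) (η - ξ) + 2 * (1 / 2) ^ p / p * ‖η - ξ‖ ^ p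
      ≤ ‖η‖ ^ p / p := by
  have h1 := powerFlux_subgradient (by linarith : 1 < p) ξ ((1 / 2 : ℝ) • (ξ + η))
  have e : (1 / 2 : ℝ) • (ξ + η) - ξ = (1 / 2 : ℝ) • (η - ξ) := by module
  have h2 := norm_rpow_clarkson hp ξ η
  rw [e, inner_smul_right] at h1
  rw [norm_smul (1 / 2 : ℝ) (η - ξ), Real.norm_of_nonneg (by norm_num),
    Real.mul_rpow (by norm_num) (norm_nonneg _)] at h2
  have h3 : 2 * (1 / 2) ^ p / p * ‖η - ξ‖ ^ p = 2 * ((1 / 2) ^ p * ‖η - ξ‖ ^ p / p) := by ring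
  have h4 := div_le_div_of_nonneg_right h2 (by linarith : 0 ≤ p)
  rw [add_div] at h4
  have h5 : (‖ξ‖ ^ p + ‖η‖ ^ p) / 2 / p = (‖ξ‖ ^ p / p + ‖η‖ ^ p / p) / 2 := by ring
  linarith

/-- Bounding by powers of 1 + ‖ξ‖ makes growth monotone in the exponent, so the α-power term (α ≤ p)
fits the same L^p framework as the p-power term. -/
lemma convexPotential_power_of_subgradient {p q c : ℝ} (hq : 1 < q) (hqp : q ≤ p)
    (h : ∀ ξ η : E, ‖ξ‖ ^ q / q + inner ℝ (powerFlux q ξ) (η - ξ) + c * ‖η - ξ‖ ^ p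
      ≤ ‖η‖ ^ q / q) :
    ConvexPotential p c (fun ξ : E => ‖ξ‖ ^ q / q) (powerFlux q) where
  continuous_pot := (continuous_norm.rpow_const fun _ => Or.inr (by linarith)).div_const _
  continuous_flux := continuous_powerFlux hq
  abs_pot_le ξ := by
    have h0 := norm_nonneg ξ
    rw [abs_of_nonneg (by positivity)]
    calc ‖ξ‖ ^ q / q ≤ ‖ξ‖ ^ q := div_le_self (by positivity) hq.le
      _ ≤ (1 + ‖ξ‖) ^ q := Real.rpow_le_rpow h0 (by linarith) (by linarith)
      _ ≤ _ := Real.rpow_le_rpow_of_exponent_le (by linarith) hqp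
  norm_flux_le ξ := by
    have h0 := norm_nonneg ξ
    rw [norm_powerFlux hq]
    calc ‖ξ‖ ^ (q - 1) ≤ (1 + ‖ξ‖) ^ (q - 1) :=
          Real.rpow_le_rpow h0 (by linarith) (by linarith)
      _ ≤ _ := Real.rpow_le_rpow_of_exponent_le (by linarith) (by linarith)
  subgradient := h

lemma convexPotential_power {p q : ℝ} (hq : 1 < q) (hqp : q ≤ p) :
    ConvexPotential p 0 (fun ξ : E => ‖ξ‖ ^ q / q) (powerFlux q) :=
  convexPotential_power_of_subgradient hq hqp fun ξ η => by
    simpa using powerFlux_subgradient hq ξ η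

lemma convexPotential_power_uniform {p : ℝ} (hp : 2 ≤ p) :
    ConvexPotential p (2 * (1 / 2) ^ p / p) (fun ξ : E => ‖ξ‖ ^ p / p) (powerFlux p) :=
  convexPotential_power_of_subgradient (by linarith) le_rfl (powerFlux_uniform_subgradient hp)

lemma negativePart_nonneg (s : ℝ) : 0 ≤ negativePart s := by
  have := le_abs_self s
  simp only [negativePart]; linarith

lemma negativePart_le_abs (s : ℝ) : negativePart s ≤ |s| := by
  have := neg_abs_le s
  simp only [negativePart]; linarith

lemma continuous_negativePart : Continuous negativePart := by
  unfold negativePart; fun_prop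

lemma negativePart_subgradient (s t : ℝ) :
    negativePart s ^ 2 / 2 + -negativePart s * (t - s) ≤ negativePart t ^ 2 / 2 := by
  unfold negativePart
  -- When s and t are both negative the gap is (t - s)²/2; the other sign cases are similar
  -- quadratic inequalities.
  rcases abs_cases s with ⟨h1, h2⟩ | ⟨h1, h2⟩ <;> rcases abs_cases t with ⟨h3, h4⟩ | ⟨h3, h4⟩ <;>
    rw [h1, h3] <;> nlinarith [sq_nonneg (s - t)]

lemma convexPotential_negativePart {p : ℝ} (hp : 2 ≤ p) :
    ConvexPotential p 0 (fun s : ℝ => negativePart s ^ 2 / 2) (fun s => -negativePart s) where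
  continuous_pot := (continuous_negativePart.pow 2).div_const 2
  continuous_flux := continuous_negativePart.neg
  abs_pot_le s := by
    have h0 := negativePart_nonneg s
    have h1 := negativePart_le_abs s
    have h2 := abs_nonneg s
    rw [abs_of_nonneg (by positivity), Real.norm_eq_abs]
    calc negativePart s ^ 2 / 2 ≤ (1 + |s|) ^ 2 := by nlinarith
      _ = (1 + |s|) ^ (2 : ℝ) := by norm_cast
      _ ≤ _ := Real.rpow_le_rpow_of_exponent_le (by linarith) hp
  norm_flux_le s := by
    have h1 := negativePart_le_abs s
    have h2 := abs_nonneg s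
    rw [norm_neg, Real.norm_of_nonneg (negativePart_nonneg s), Real.norm_eq_abs]
    calc negativePart s ≤ (1 + |s|) ^ (1 : ℝ) := by rw [Real.rpow_one]; linarith
      _ ≤ _ := Real.rpow_le_rpow_of_exponent_le (by linarith) (by linarith)
  subgradient s t := by
    simpa [mul_comm] using negativePart_subgradient s t

end Potentials

/-! ### Integral functionals on L^p and their derivatives -/

section IntegralFunctionals

variable {S : Type*} [MeasurableSpace S] {ν : Measure S}
  {E : Type*} [NormedAddCommGroup E] [InnerProductSpace ℝ E]
  {p p' : ℝ}

lemma integrable_inner_of_memLp (hpp : p'.HolderConjugate p) {g h : S → E}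
    (hg : MemLp g (ENNReal.ofReal p') ν) (hh : MemLp h (ENNReal.ofReal p) ν) :
    Integrable (fun x => inner ℝ (g x) (h x)) ν := by
  have := hpp.ennrealOfReal
  have h1 : Integrable (fun x => ‖g x‖ * ‖h x‖) ν := hg.norm.integrable_mul hh.norm
  refine h1.mono' (hg.1.inner hh.1) (Eventually.of_forall fun x => ?_)
  exact norm_inner_le_norm _ _

/-- Every `g ∈ L^{p'}` defines a continuous linear functional on `L^p`. -/
lemma exists_dual_of_memLp [Fact (1 ≤ ENNReal.ofReal p)] (hpp : p'.HolderConjugate p) {g : S → E}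
    (hg : MemLp g (ENNReal.ofReal p') ν) :
    ∃ L : Lp E (ENNReal.ofReal p) ν →L[ℝ] ℝ, ∀ v, L v = ∫ x, inner ℝ (g x) (v x) ∂ν := by
  have := hpp.ennrealOfReal
  have : Fact (1 ≤ ENNReal.ofReal p') := ⟨by simpa using hpp.lt.le⟩
  refine ⟨(innerSL ℝ).lpPairing ν (ENNReal.ofReal p') (ENNReal.ofReal p) (hg.toLp g),
    fun v => ?_⟩
  rw [ContinuousLinearMap.lpPairing_eq_integral]
  refine integral_congr_ae ?_
  filter_upwards [hg.coeFn_toLp] with x hx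
  rw [hx]
  rfl

lemma norm_rpow_eq_integral {F : Type*} [NormedAddCommGroup F] (hp : 0 < p)
    (u : Lp F (ENNReal.ofReal p) ν) :
    ‖u‖ ^ p = ∫ x, ‖u x‖ ^ p ∂ν := by
  have h0 : 0 ≤ ∫ x, ‖u x‖ ^ p ∂ν := integral_nonneg fun x => by positivity
  rw [Lp.norm_def, (Lp.memLp u).eLpNorm_eq_integral_rpow_norm
    (by simpa using hp) ENNReal.ofReal_ne_top, ENNReal.toReal_ofReal hp.le,
    ENNReal.toReal_ofReal (by positivity), ← Real.rpow_mul h0, inv_mul_cancel₀ hp.ne',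
    Real.rpow_one]

/-- As p' = p/(p-1), the p'-th power of the function is (1 + |f|)^p; finiteness of ν puts the
constant 1 in L^p. -/
lemma memLp_growth [IsFiniteMeasure ν] (hpp : p'.HolderConjugate p) {f : S → ℝ}
    (hf : MemLp f (ENNReal.ofReal p) ν) :
    MemLp (fun x => (1 + |f x|) ^ (p - 1)) (ENNReal.ofReal p') ν := by
  have h1 : MemLp (fun x => 1 + |f x|) (ENNReal.ofReal p) ν := by
    have h0 : MemLp (fun _ : S => (1 : ℝ)) (ENNReal.ofReal p) ν := memLp_const 1
    exact h0.add hf.norm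
  have hp1 : 0 < p - 1 := by have := hpp.symm.lt; linarith
  have h2 := h1.norm_rpow_div (ENNReal.ofReal (p - 1))
  rw [ENNReal.toReal_ofReal hp1.le, ← ENNReal.ofReal_div_of_pos hp1] at h2
  rw [hpp.symm.conjugate_eq]
  refine h2.congr_norm ?_ ?_
  · exact ((h1.1.aemeasurable).pow_const _).aestronglyMeasurable
  · refine Eventually.of_forall fun x => ?_
    rw [Real.norm_of_nonneg (by positivity : 0 ≤ 1 + |f x|)]

lemma integrable_growth [IsFiniteMeasure ν] (hp : 0 < p) {f : S → ℝ}
    (hf : MemLp f (ENNReal.ofReal p) ν) :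
    Integrable (fun x => (1 + |f x|) ^ p) ν := by
  have h1 : MemLp (fun x => 1 + |f x|) (ENNReal.ofReal p) ν := by
    have h0 : MemLp (fun _ : S => (1 : ℝ)) (ENNReal.ofReal p) ν := memLp_const 1
    exact h0.add hf.norm
  have h2 := h1.integrable_norm_rpow (by simpa using hp) ENNReal.ofReal_ne_top
  rw [ENNReal.toReal_ofReal hp.le] at h2
  refine h2.congr (Eventually.of_forall fun x => ?_)
  simp only [Real.norm_of_nonneg (by positivity : 0 ≤ 1 + |f x|)]

variable {c w₁ w₂ : ℝ} {B : E → ℝ} {b : E → E} {w : S → ℝ}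

lemma ConvexPotential.memLp_flux [IsFiniteMeasure ν] (hB : ConvexPotential p c B b)
    (hpp : p'.HolderConjugate p) {u : S → E} (hu : MemLp u (ENNReal.ofReal p) ν) :
    MemLp (fun x => b (u x)) (ENNReal.ofReal p') ν := by
  refine (memLp_growth hpp hu.norm).mono (hB.continuous_flux.comp_aestronglyMeasurable hu.1)
    (Eventually.of_forall fun x => ?_)
  rw [abs_of_nonneg (norm_nonneg _), Real.norm_of_nonneg (by positivity)]
  exact hB.norm_flux_le _

lemma memLp_bounded_smul {q : ℝ≥0∞} {g : S → E} (hg : MemLp g q ν)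
    (hw : AEStronglyMeasurable w ν) (hw₂ : ∀ᵐ x ∂ν, |w x| ≤ w₂) :
    MemLp (fun x => w x • g x) q ν := by
  refine hg.of_le_mul (c := w₂) (hw.smul hg.1) ?_
  filter_upwards [hw₂] with x hx
  rw [norm_smul]
  exact mul_le_mul_of_nonneg_right hx (norm_nonneg _)

lemma ConvexPotential.integrable_pot [IsFiniteMeasure ν] (hB : ConvexPotential p c B b)
    (hp : 0 < p)
    (hw : AEStronglyMeasurable w ν) (hw₂ : ∀ᵐ x ∂ν, |w x| ≤ w₂)
    {u : S → E} (hu : MemLp u (ENNReal.ofReal p) ν) :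
    Integrable (fun x => w x * B (u x)) ν := by
  refine ((integrable_growth hp hu.norm).const_mul w₂).mono'
    (hw.mul (hB.continuous_pot.comp_aestronglyMeasurable hu.1)) ?_
  filter_upwards [hw₂] with x hx
  rw [norm_mul, abs_of_nonneg (norm_nonneg _)]
  exact mul_le_mul hx (hB.abs_pot_le _) (norm_nonneg _) ((abs_nonneg _).trans hx)

/-- The integral functional `u ↦ ∫ w B(u)` on `L^p` has the derivative `A u = ∫ w ⟪b(u), ·⟫` in the
dual of `L^p`, it is uniformly convex if `c > 0`, and `A` is hemicontinuous. -/
theorem ConvexPotential.exists_dual [Fact (1 ≤ ENNReal.ofReal p)] [IsFiniteMeasure ν]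
    (hB : ConvexPotential p c B b) (hc : 0 ≤ c) (hpp : p'.HolderConjugate p)
    (hw₁ : 0 ≤ w₁) (hw : AEStronglyMeasurable w ν) (hwb : ∀ᵐ x ∂ν, w₁ ≤ w x ∧ w x ≤ w₂) :
    ∃ A : Lp E (ENNReal.ofReal p) ν → Lp E (ENNReal.ofReal p) ν →L[ℝ] ℝ,
      (∀ u v, A u v = ∫ x, w x * inner ℝ (b (u x)) (v x) ∂ν) ∧
      (∀ u v, ∫ x, w x * B (u x) ∂ν + A u (v - u) + c * w₁ * ‖v - u‖ ^ p
        ≤ ∫ x, w x * B (v x) ∂ν) ∧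
      (∀ u v, Tendsto (fun t : ℝ => A (u + t • v) v) (𝓝[>] 0) (𝓝 (A u v))) := by
  have hp : 0 < p := hpp.symm.pos
  have hp1 : 0 < p - 1 := by have := hpp.symm.lt; linarith
  have hwabs : ∀ᵐ x ∂ν, |w x| ≤ w₂ := by
    filter_upwards [hwb] with x hx
    rw [abs_of_nonneg (hw₁.trans hx.1)]; exact hx.2
  have hflux : ∀ u : Lp E (ENNReal.ofReal p) ν,
      MemLp (fun x => w x • b (u x)) (ENNReal.ofReal p') ν := fun u =>
    memLp_bounded_smul (hB.memLp_flux hpp (Lp.memLp u)) hw hwabs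
  choose A hA using fun u => exists_dual_of_memLp hpp (hflux u)
  have hA' : ∀ u v, A u v = ∫ x, w x * inner ℝ (b (u x)) (v x) ∂ν := fun u v => by
    rw [hA]; simp only [real_inner_smul_left]
  refine ⟨A, hA', fun u v => ?_, fun u v => ?_⟩
  · have i1 := hB.integrable_pot hp hw hwabs (Lp.memLp u)
    have i2 := integrable_inner_of_memLp hpp (hflux u) (Lp.memLp (v - u))
    have i3 : Integrable (fun x => c * w₁ * ‖(v - u) x‖ ^ p) ν := by
      have := (Lp.memLp (v - u)).integrable_norm_rpow (by simpa using hp) ENNReal.ofReal_ne_top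
      rw [ENNReal.toReal_ofReal hp.le] at this
      exact this.const_mul _
    have i4 := hB.integrable_pot hp hw hwabs (Lp.memLp v)
    have i5 : Integrable (fun x => w x * B (u x) + inner ℝ (w x • b (u x)) ((v - u) x)) ν :=
      i1.add i2
    rw [hA, norm_rpow_eq_integral hp, ← integral_const_mul, ← integral_add i1 i2,
      ← integral_add i5 i3]
    refine integral_mono_ae (i5.add i3) i4 ?_
    filter_upwards [hwb, Lp.coeFn_sub v u] with x hx hs
    have hsub := hB.subgradient (u x) (v x)
    simp only [hs, Pi.sub_apply, real_inner_smul_left]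
    -- The convexity gain is nonnegative, so its weight w x may be lowered to w₁.
    have h0 : 0 ≤ c * ‖v x - u x‖ ^ p := by positivity
    have h1 := mul_le_mul_of_nonneg_left hsub (hw₁.trans hx.1)
    have h2 := mul_le_mul_of_nonneg_right hx.1 h0
    linarith
  · simp only [hA]
    -- Hemicontinuity by dominated convergence: for 0 < t ≤ 1 the argument u + t v is bounded by ‖u‖
    -- + ‖v‖, and Hölder's inequality makes the resulting dominating function integrable.
    have hm : MemLp (fun x => ‖u x‖ + ‖v x‖) (ENNReal.ofReal p) ν :=
      (Lp.memLp u).norm.add (Lp.memLp v).norm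
    have hbd := memLp_growth hpp hm
    have hbi : Integrable (fun x => w₂ * ((1 + |‖u x‖ + ‖v x‖|) ^ (p - 1) * ‖v x‖)) ν := by
      have := hpp.ennrealOfReal
      exact (hbd.integrable_mul (Lp.memLp v).norm).const_mul _
    have hu0 : ∀ t : ℝ, (u + t • v : Lp E (ENNReal.ofReal p) ν) =ᵐ[ν] fun x => u x + t • v x :=
      fun t => by
        filter_upwards [Lp.coeFn_add u (t • v), Lp.coeFn_smul t v] with x h1 h2
        rw [h1, Pi.add_apply, h2, Pi.smul_apply]
    have hcongr : ∀ t : ℝ, ∫ x, inner ℝ (w x • b ((u + t • v) x)) (v x) ∂ν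
        = ∫ x, inner ℝ (w x • b (u x + t • v x)) (v x) ∂ν := fun t => by
      refine integral_congr_ae ?_
      filter_upwards [hu0 t] with x hx
      rw [hx]
    simp only [hcongr]
    refine tendsto_integral_filter_of_dominated_convergence _ ?_ ?_ hbi ?_
    · refine Eventually.of_forall fun t => ?_
      exact (hw.smul (hB.continuous_flux.comp_aestronglyMeasurable
        ((Lp.aestronglyMeasurable u).add ((Lp.aestronglyMeasurable v).const_smul t)))).inner
        (Lp.aestronglyMeasurable v)
    · filter_upwards [Ioc_mem_nhdsGT (zero_lt_one' ℝ)] with t ht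
      filter_upwards [hwabs] with x hx
      have h1 : ‖u x + t • v x‖ ≤ ‖u x‖ + ‖v x‖ := by
        refine (norm_add_le _ _).trans (add_le_add_right ?_ _)
        rw [norm_smul, Real.norm_of_nonneg ht.1.le]
        exact mul_le_of_le_one_left (norm_nonneg _) ht.2
      have h2 : ‖b (u x + t • v x)‖ ≤ (1 + |‖u x‖ + ‖v x‖|) ^ (p - 1) := by
        refine (hB.norm_flux_le _).trans (Real.rpow_le_rpow (by positivity) ?_ hp1.le)
        rw [abs_of_nonneg (by positivity)]
        linarith
      refine (norm_inner_le_norm _ _).trans ?_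
      rw [norm_smul, ← mul_assoc]
      exact mul_le_mul_of_nonneg_right
        (mul_le_mul hx h2 (norm_nonneg _) ((abs_nonneg _).trans hx)) (norm_nonneg _)
    · refine Eventually.of_forall fun x => ?_
      have hcont : Continuous fun t : ℝ => inner ℝ (w x • b (u x + t • v x)) (v x) := by
        have := hB.continuous_flux
        fun_prop
      have := (hcont.tendsto 0).mono_left (nhdsWithin_le_nhds (s := Ioi 0))
      simpa using this

end IntegralFunctionals

/-! ### Completeness of W₀^{1,p} and the Poincaré inequality -/

section Sobolev

variable {Ω : Opens Plane} {p p' : ℝ}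

/-- For each fixed test function, both sides of the weak gradient identity are pairings with an
element of L^{p'}, hence continuous in the pair. -/
lemma isClosed_sobolevW [Fact (1 ≤ ENNReal.ofReal p)] (hpp : p'.HolderConjugate p) :
    IsClosed (SobolevW Ω (ENNReal.ofReal p) :
      Set (LpScalar Ω (ENNReal.ofReal p) × LpVector Ω (ENNReal.ofReal p))) := by
  have := hpp.ennrealOfReal
  have : Fact (1 ≤ ENNReal.ofReal p') := ⟨by simpa using hpp.lt.le⟩
  set ν := volume.restrict (Ω : Set Plane)
  have hset : (SobolevW Ω (ENNReal.ofReal p) :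
      Set (LpScalar Ω (ENNReal.ofReal p) × LpVector Ω (ENNReal.ofReal p)))
      = ⋂ φ : 𝓓(Ω, ℝ), {w | ∫ x in Ω, w.1 x • gradient φ x = -∫ x in Ω, φ x • w.2 x} := by
    ext w; simp only [mem_iInter]; rfl
  rw [hset]
  refine isClosed_iInter fun φ => isClosed_eq ?_ (Continuous.neg ?_)
  · have hg : MemLp (gradient φ) (ENNReal.ofReal p') ν :=
      ((continuous_gradient φ).memLp_of_hasCompactSupport (hasCompactSupport_gradient φ))
    have hc := (((ContinuousLinearMap.lsmul ℝ ℝ).flip : Plane →L[ℝ] ℝ →L[ℝ] Plane).lpPairing ν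
      (ENNReal.ofReal p') (ENNReal.ofReal p) (hg.toLp _)).continuous
    refine (hc.comp continuous_fst).congr fun w => ?_
    rw [Function.comp_apply, ContinuousLinearMap.lpPairing_eq_integral]
    refine integral_congr_ae ?_
    filter_upwards [hg.coeFn_toLp] with x hx
    simp [hx]
  · have hg : MemLp φ (ENNReal.ofReal p') ν :=
      φ.continuous.memLp_of_hasCompactSupport φ.hasCompactSupport
    have hc := ((ContinuousLinearMap.lsmul ℝ ℝ : ℝ →L[ℝ] Plane →L[ℝ] Plane).lpPairing ν
      (ENNReal.ofReal p') (ENNReal.ofReal p) (hg.toLp _)).continuous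
    refine (hc.comp continuous_snd).congr fun w => ?_
    rw [Function.comp_apply, ContinuousLinearMap.lpPairing_eq_integral]
    refine integral_congr_ae ?_
    filter_upwards [hg.coeFn_toLp] with x hx
    simp [hx]

lemma completeSpace_sobolevW0 [Fact (1 ≤ ENNReal.ofReal p)] (hpp : p'.HolderConjugate p) :
    CompleteSpace (SobolevW0 Ω (ENNReal.ofReal p)) := by
  have : CompleteSpace (SobolevW Ω (ENNReal.ofReal p)) :=
    (isClosed_sobolevW hpp).completeSpace_coe
  exact (testSubmodule Ω (ENNReal.ofReal p)).isClosed_topologicalClosure.completeSpace_coe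

lemma norm_gradient (φ : 𝓓(Ω, ℝ)) (x : Plane) : ‖gradient φ x‖ = ‖fderiv ℝ φ x‖ := by
  simp [gradient]

lemma volume_lt_top_of_isBounded (hΩ : Bornology.IsBounded (Ω : Set Plane)) :
    volume (Ω : Set Plane) < ∞ := hΩ.measure_lt_top

/-- The Gagliardo–Nirenberg–Sobolev inequality bounds the L^p norm by the L^r norm of the gradient;
Hölder's inequality on the bounded set Ω then raises r to p. -/
lemma exists_poincare_testFunction (hΩ : Bornology.IsBounded (Ω : Set Plane)) (hp : 2 < p) :
    ∃ C : ℝ≥0∞, C ≠ ∞ ∧ ∀ φ : 𝓓(Ω, ℝ),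
      eLpNorm φ (ENNReal.ofReal p) (volume.restrict (Ω : Set Plane))
        ≤ C * eLpNorm (gradient φ) (ENNReal.ofReal p) (volume.restrict (Ω : Set Plane)) := by
  -- This r has planar Sobolev conjugate exactly p: 1/r - 1/2 = 1/p.
  set r : ℝ≥0 := (2 * p / (p + 2)).toNNReal
  have hr : (r : ℝ) = 2 * p / (p + 2) := Real.coe_toNNReal _ (by positivity)
  have hq : ((p.toNNReal : ℝ≥0) : ℝ) = p := Real.coe_toNNReal _ (by linarith)
  have hr1 : 1 ≤ r := by
    rw [← NNReal.coe_le_coe, hr, NNReal.coe_one, le_div_iff₀ (by linarith)]; linarith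
  have hr2 : (r : ℝ) < 2 := by
    rw [hr, div_lt_iff₀ (by linarith)]; linarith
  have hrp : (r : ℝ≥0∞) ≤ ENNReal.ofReal p := by
    refine ENNReal.coe_le_coe.2 ?_
    rw [← NNReal.coe_le_coe, hq]; linarith
  have hfin : Module.finrank ℝ Plane = 2 := by simp [Plane]
  have hvol := volume_lt_top_of_isBounded hΩ
  set C₁ := eLpNormLESNormFDerivOfLeConst ℝ (volume : Measure Plane) (Ω : Set Plane) r p.toNNReal
  set K : ℝ≥0∞ := (volume.restrict (Ω : Set Plane)) univ ^
    (1 / (r : ℝ≥0∞).toReal - 1 / (ENNReal.ofReal p).toReal)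
  refine ⟨C₁ * K, ?_, fun φ => ?_⟩
  · refine ENNReal.mul_ne_top ENNReal.coe_ne_top (ENNReal.rpow_ne_top_of_nonneg ?_ ?_)
    · rw [ENNReal.coe_toReal, ENNReal.toReal_ofReal (by linarith), sub_nonneg]
      exact one_div_le_one_div_of_le (by linarith [NNReal.coe_le_coe.2 hr1, NNReal.coe_one])
        (by linarith)
    · simpa using hvol.ne
  · have hsupp : Function.support φ ⊆ (Ω : Set Plane) :=
      (subset_tsupport _).trans φ.tsupport_subset
    have hsupp' : Function.support (gradient φ) ⊆ (Ω : Set Plane) := by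
      refine Subset.trans (fun x hx => ?_) ((support_fderiv_subset ℝ).trans φ.tsupport_subset)
      rw [Function.mem_support, ← norm_ne_zero_iff, norm_gradient, norm_ne_zero_iff] at hx
      exact hx
    have hgrad' : eLpNorm (gradient φ) r (volume.restrict (Ω : Set Plane))
        = eLpNorm (gradient φ) r volume := eLpNorm_restrict_eq_of_support_subset hsupp'
    have hgrad : ∀ (q : ℝ≥0∞) (m : Measure Plane),
        eLpNorm (fderiv ℝ φ) q m = eLpNorm (gradient φ) q m := fun q m =>
      eLpNorm_congr_norm_ae (Eventually.of_forall fun x => (norm_gradient φ x).symm)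
    have h1 := eLpNorm_le_eLpNorm_fderiv_of_le (volume : Measure Plane) (u := φ)
      (φ.contDiff.of_le (by exact_mod_cast le_top)) hsupp (p := r) (q := p.toNNReal) hr1
      (by rw [hfin]; exact_mod_cast hr2)
      (by
        rw [hfin, hq, NNReal.coe_inv, hr, inv_div]
        refine le_of_eq ?_
        have : p ≠ 0 := by linarith
        push_cast
        field_simp
        ring) hΩ
    have h2 := eLpNorm_le_eLpNorm_mul_rpow_measure_univ (μ := volume.restrict (Ω : Set Plane)) hrp
      (continuous_gradient φ).aestronglyMeasurable
    calc eLpNorm φ (ENNReal.ofReal p) (volume.restrict (Ω : Set Plane))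
        ≤ eLpNorm φ (ENNReal.ofReal p) volume := eLpNorm_restrict_le _ _ _ _
      _ ≤ C₁ * eLpNorm (fderiv ℝ φ) r volume := h1
      _ = C₁ * eLpNorm (gradient φ) r (volume.restrict (Ω : Set Plane)) := by
        rw [hgrad, hgrad']
      _ ≤ C₁ * (eLpNorm (gradient φ) (ENNReal.ofReal p) (volume.restrict (Ω : Set Plane)) * K) :=
        mul_le_mul_right h2 _
      _ = _ := by rw [mul_comm _ K, mul_assoc]

/-- The Poincaré inequality in `W₀^{1,p}` of a bounded open set of the plane. -/
theorem exists_poincare [Fact (1 ≤ ENNReal.ofReal p)]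
    (hΩ : Bornology.IsBounded (Ω : Set Plane)) (hp : 2 < p) :
    ∃ C : ℝ, 0 ≤ C ∧ ∀ u : SobolevW0 Ω (ENNReal.ofReal p), ‖u.1.1.1‖ ≤ C * ‖u.1.1.2‖ := by
  obtain ⟨C, hC, h⟩ := exists_poincare_testFunction hΩ hp
  refine ⟨C.toReal, ENNReal.toReal_nonneg, fun u => ?_⟩
  -- Both norms are continuous on W^{1,p}, so the bound passes from test functions to their closure.
  have hclosed : IsClosed {w : SobolevW Ω (ENNReal.ofReal p) | ‖w.1.1‖ ≤ C.toReal * ‖w.1.2‖} :=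
    isClosed_le (by fun_prop) (by fun_prop)
  have hsub : (testSubmodule Ω (ENNReal.ofReal p) : Set (SobolevW Ω (ENNReal.ofReal p)))
      ⊆ {w | ‖w.1.1‖ ≤ C.toReal * ‖w.1.2‖} := by
    rintro w ⟨φ, h1, h2⟩
    have h3 := h φ
    rw [← eLpNorm_congr_ae h1, ← eLpNorm_congr_ae h2] at h3
    rw [mem_ofPred_eq, Lp.norm_def, Lp.norm_def, ← ENNReal.toReal_mul]
    exact ENNReal.toReal_mono (ENNReal.mul_ne_top hC (Lp.eLpNorm_ne_top _)) h3
  exact closure_minimal hsub hclosed u.2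

end Sobolev

/-! ### Integrability of the source term -/

section Source

variable {Ω : Opens Plane}

lemma memLp_extendZero [IsFiniteMeasure (volume.restrict (Ω : Set Plane))] (f : ContClosure Ω)
    (q : ℝ≥0∞) : MemLp (extendZero f) q (volume.restrict (Ω : Set Plane)) := by
  have hm : Measurable (extendZero f) :=
    (MeasurableEmbedding.subtype_coe isClosed_closure.measurableSet).measurable_extend
      f.continuous.measurable measurable_const
  refine MemLp.of_bound hm.aestronglyMeasurable ‖f‖ (Eventually.of_forall fun x => ?_)
  by_cases hx : x ∈ closure (Ω : Set Plane)
  · have : extendZero f x = f ⟨x, hx⟩ :=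
      Subtype.val_injective.extend_apply f 0 (⟨x, hx⟩ : closure (Ω : Set Plane))
    rw [this]
    exact f.norm_coe_le_norm _
  · have : extendZero f x = 0 :=
      Function.extend_apply' _ _ _ (by rintro ⟨y, rfl⟩; exact hx y.2)
    rw [this, norm_zero]
    exact norm_nonneg _

end Source

/-! ### Unique solvability with abstract embedding and gradient operators -/

section Composite

variable {X Y Z : Type*} [NormedAddCommGroup X] [NormedSpace ℝ X] [CompleteSpace X]
  [NormedAddCommGroup Y] [NormedSpace ℝ Y] [NormedAddCommGroup Z] [NormedSpace ℝ Z]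

/-- Unique solvability for the sum of two convex functionals of `ι u` and a uniformly convex
functional of `D u`, where `D` is bounded below. -/
theorem existsUnique_of_uniformlyConvex_comp {ι : X →L[ℝ] Y} {D : X →L[ℝ] Z} {C c p : ℝ}
    (hC : 0 < C) (hc : 0 < c) (hp : 1 < p) (hD : ∀ u, ‖u‖ ≤ C * ‖D u‖)
    {J₁ J₃ : Y → ℝ} {A₁ A₃ : Y → Y →L[ℝ] ℝ} {J₂ : Z → ℝ} {A₂ : Z → Z →L[ℝ] ℝ}
    (hJ₁ : ∀ u w, J₁ u + A₁ u (w - u) ≤ J₁ w)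
    (hJ₂ : ∀ u w, J₂ u + A₂ u (w - u) + c * ‖w - u‖ ^ p ≤ J₂ w)
    (hJ₃ : ∀ u w, J₃ u + A₃ u (w - u) ≤ J₃ w)
    (hA₁ : ∀ u v, Tendsto (fun t : ℝ => A₁ (u + t • v) v) (𝓝[>] 0) (𝓝 (A₁ u v)))
    (hA₂ : ∀ u v, Tendsto (fun t : ℝ => A₂ (u + t • v) v) (𝓝[>] 0) (𝓝 (A₂ u v)))
    (hA₃ : ∀ u v, Tendsto (fun t : ℝ => A₃ (u + t • v) v) (𝓝[>] 0) (𝓝 (A₃ u v)))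
    (F : Y →L[ℝ] ℝ) :
    ∃! u, ∀ v, A₁ (ι u) (ι v) + A₂ (D u) (D v) + A₃ (ι u) (ι v) = F (ι v) := by
  let A : X → X →L[ℝ] ℝ := fun u => (A₁ (ι u) + A₃ (ι u) - F).comp ι + (A₂ (D u)).comp D
  let J : X → ℝ := fun u => J₁ (ι u) + J₂ (D u) + J₃ (ι u) - F (ι u)
  have hAapp : ∀ u v, A u v = A₁ (ι u) (ι v) + A₃ (ι u) (ι v) - F (ι v) + A₂ (D u) (D v) :=
    fun _ _ => rfl
  have hJA : ∀ u w, J u + A u (w - u) + c / C ^ p * ‖w - u‖ ^ p ≤ J w := by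
    intro u w
    have h1 := hJ₁ (ι u) (ι w)
    have h2 := hJ₂ (D u) (D w)
    have h3 := hJ₃ (ι u) (ι w)
    -- The lower bound on D turns convexity in D u into convexity in u, at the cost of the factor
    -- C^p.
    have h4 : c / C ^ p * ‖w - u‖ ^ p ≤ c * ‖D w - D u‖ ^ p := by
      have h5 := Real.rpow_le_rpow (norm_nonneg _) (hD (w - u)) (by linarith : 0 ≤ p)
      rw [Real.mul_rpow hC.le (norm_nonneg _), map_sub] at h5
      calc c / C ^ p * ‖w - u‖ ^ p ≤ c / C ^ p * (C ^ p * ‖D w - D u‖ ^ p) := by gcongr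
        _ = _ := by field_simp
    rw [hAapp]
    simp only [J, map_sub] at h1 h2 h3 ⊢
    linarith
  have hhem : ∀ u v, Tendsto (fun t : ℝ => A (u + t • v) v) (𝓝[>] 0) (𝓝 (A u v)) := by
    intro u v
    simp only [hAapp, map_add, map_smul]
    exact (((hA₁ (ι u) (ι v)).add (hA₃ (ι u) (ι v))).sub tendsto_const_nhds).add
      (hA₂ (D u) (D v))
  have hiff : ∀ u, A u = 0 ↔
      ∀ v, A₁ (ι u) (ι v) + A₂ (D u) (D v) + A₃ (ι u) (ι v) = F (ι v) := by
    intro u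
    rw [ContinuousLinearMap.ext_iff]
    refine forall_congr' fun v => ?_
    rw [hAapp, zero_apply]
    constructor <;> intro h <;> linarith
  have key := existsUnique_zero_of_uniformlyConvex (by positivity) hp hJA hhem
  simpa only [hiff] using key

/-- Unique solvability of the weak form of `|u|^{α-2} u / ℓ - div (μ |∇u|^{p-2} ∇u) - u⁻ / κ = F`
for abstract embedding and gradient operators. -/
theorem existsUnique_energy {S E : Type*} [MeasurableSpace S] {ν : Measure S} [IsFiniteMeasure ν]
    [NormedAddCommGroup E] [InnerProductSpace ℝ E] {p α : ℝ} [Fact (1 ≤ ENNReal.ofReal p)]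
    (hp : 2 ≤ p) (hα : 1 < α) (hαp : α ≤ p) {μ : S → ℝ} (hμ : AEStronglyMeasurable μ ν)
    {ℓ κ μ₁ μ₂ : ℝ} (hℓ : 0 ≤ ℓ) (hκ : 0 ≤ κ) (hμ₁ : 0 < μ₁)
    (hμb : ∀ᵐ x ∂ν, μ₁ ≤ μ x ∧ μ x ≤ μ₂) {C : ℝ} (hC : 0 < C)
    (ι : X →L[ℝ] Lp ℝ (ENNReal.ofReal p) ν) (D : X →L[ℝ] Lp E (ENNReal.ofReal p) ν)
    (hD : ∀ u, ‖u‖ ≤ C * ‖D u‖) (F : Lp ℝ (ENNReal.ofReal p) ν →L[ℝ] ℝ) :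
    ∃! u, ∀ v, ∫ x, 1 / ℓ * inner ℝ (powerFlux α (ι u x)) (ι v x) ∂ν
      + ∫ x, μ x * inner ℝ (powerFlux p (D u x)) (D v x) ∂ν
      + ∫ x, 1 / κ * inner ℝ (-negativePart (ι u x)) (ι v x) ∂ν = F (ι v) := by
  have hp1 : 1 < p := by linarith
  have hpp : (p / (p - 1)).HolderConjugate p := (Real.HolderConjugate.conjExponent hp1).symm
  obtain ⟨A₁, hA₁, hJ₁, hh₁⟩ := (convexPotential_power (E := ℝ) hα hαp).exists_dual (ν := ν)
    (w := fun _ => 1 / ℓ) le_rfl hpp (by positivity : 0 ≤ 1 / ℓ) aestronglyMeasurable_const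
    (Eventually.of_forall fun _ => ⟨le_rfl, le_rfl⟩)
  obtain ⟨A₂, hA₂, hJ₂, hh₂⟩ := (convexPotential_power_uniform (E := E) hp).exists_dual
    (ν := ν) (w := μ) (by positivity) hpp hμ₁.le hμ hμb
  obtain ⟨A₃, hA₃, hJ₃, hh₃⟩ := (convexPotential_negativePart hp).exists_dual (ν := ν)
    (w := fun _ => 1 / κ) le_rfl hpp (by positivity : 0 ≤ 1 / κ) aestronglyMeasurable_const
    (Eventually.of_forall fun _ => ⟨le_rfl, le_rfl⟩)
  have hc : 0 < 2 * (1 / 2) ^ p / p * μ₁ := by positivity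
  simp only [zero_mul, add_zero] at hJ₁ hJ₃
  have key := existsUnique_of_uniformlyConvex_comp (ι := ι) (D := D) hC hc hp1 hD hJ₁ hJ₂ hJ₃
    hh₁ hh₂ hh₃ F
  simpa only [hA₁, hA₂, hA₃] using key

end Composite

/-! ### The time-step problem and its iteration -/

section StepProblem

variable {Ω : Opens Plane} {p : ℝ} [Fact (1 ≤ ENNReal.ofReal p)]

lemma one_lt_alpha {p : ℝ} (hp : 1 < p) : 1 < alpha p := by
  rw [alpha, lt_div_iff₀ (by linarith)]; linarith

lemma alpha_le {p : ℝ} (hp : 2 ≤ p) : alpha p ≤ p := by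
  rw [alpha, div_le_iff₀ (by linarith)]; nlinarith

variable (Ω p) in
/-- The embedding of `W₀^{1,p}` into `L^p`. -/
noncomputable def toLpCLM : SobolevW0 Ω (ENNReal.ofReal p) →L[ℝ] LpScalar Ω (ENNReal.ofReal p) :=
  (ContinuousLinearMap.fst ℝ _ _).comp
    ((SobolevW Ω (ENNReal.ofReal p)).subtypeL.comp (SobolevW0 Ω (ENNReal.ofReal p)).subtypeL)

variable (Ω p) in
/-- The weak gradient as an operator from `W₀^{1,p}` to `L^p`. -/
noncomputable def gradCLM : SobolevW0 Ω (ENNReal.ofReal p) →L[ℝ] LpVector Ω (ENNReal.ofReal p) :=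
  (ContinuousLinearMap.snd ℝ _ _).comp
    ((SobolevW Ω (ENNReal.ofReal p)).subtypeL.comp (SobolevW0 Ω (ENNReal.ofReal p)).subtypeL)

lemma exists_norm_le_gradCLM (hΩ : Bornology.IsBounded (Ω : Set Plane)) (hp : 2 < p) :
    ∃ C : ℝ, 0 < C ∧ ∀ u : SobolevW0 Ω (ENNReal.ofReal p), ‖u‖ ≤ C * ‖gradCLM Ω p u‖ := by
  obtain ⟨C, hC, h⟩ := exists_poincare hΩ hp
  -- The norm of a pair is a maximum: C handles the function component, 1 the gradient component.
  refine ⟨C + 1, by linarith, fun u => ?_⟩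
  have h1 : ‖u‖ = max ‖u.1.1.1‖ ‖u.1.1.2‖ := rfl
  have h2 : ‖gradCLM Ω p u‖ = ‖u.1.1.2‖ := rfl
  have h3 := norm_nonneg u.1.1.2
  rw [h1, h2]
  exact max_le (by linarith [h u]) (by nlinarith)

theorem existsUnique_isStepSolution (hΩ : Bornology.IsBounded (Ω : Set Plane)) (hp : 2 < p)
    {κ ℓ : ℝ} (hκ : 0 < κ) (hℓ : 0 < ℓ) {μ : Plane → ℝ}
    (hμ : AEStronglyMeasurable μ (volume.restrict (Ω : Set Plane))) {μ₁ μ₂ : ℝ} (hμ₁ : 0 < μ₁)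
    (hμbd : ∀ x ∈ Ω, μ₁ ≤ μ x ∧ μ x ≤ μ₂) (a : ℝ → ContClosure Ω) (n : ℕ)
    (uPrev : SobolevW0 Ω (ENNReal.ofReal p)) :
    ∃! uNext : SobolevW0 Ω (ENNReal.ofReal p), IsStepSolution κ ℓ μ a n uPrev uNext := by
  have hp1 : 1 < p := by linarith
  have hpp : (p / (p - 1)).HolderConjugate p := (Real.HolderConjugate.conjExponent hp1).symm
  have : IsFiniteMeasure (volume.restrict (Ω : Set Plane)) :=
    ⟨by simpa using volume_lt_top_of_isBounded hΩ⟩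
  have : CompleteSpace (SobolevW0 Ω (ENNReal.ofReal p)) := completeSpace_sobolevW0 hpp
  obtain ⟨C, hC, hnorm⟩ := exists_norm_le_gradCLM hΩ hp
  have hpot := convexPotential_power (E := ℝ) (one_lt_alpha hp1) (alpha_le hp.le)
  -- The previous iterate enters only through the fixed functional L₁, so it moves to the right-hand
  -- side together with the source L₂.
  obtain ⟨L₁, hL₁⟩ := exists_dual_of_memLp hpp
    (hpot.memLp_flux hpp (Lp.memLp (toLpCLM Ω p uPrev)))
  obtain ⟨L₂, hL₂⟩ := exists_dual_of_memLp hpp (memLp_extendZero (sourceMean a ℓ n) _)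
  have hμae : ∀ᵐ x ∂(volume.restrict (Ω : Set Plane)), μ₁ ≤ μ x ∧ μ x ≤ μ₂ :=
    (ae_restrict_mem Ω.isOpen.measurableSet).mono fun x hx => hμbd x hx
  have h := existsUnique_energy (X := SobolevW0 Ω (ENNReal.ofReal p)) (E := Plane) hp.le
    (one_lt_alpha hp1) (alpha_le hp.le) hμ hℓ.le hκ.le hμ₁ hμae hC
  have key := h (toLpCLM Ω p) (gradCLM Ω p) hnorm ((1 / ℓ) • L₁ + L₂)
  have hinner : ∀ s t : ℝ, inner ℝ s t = s * t := fun s t => by simp [mul_comm]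
  refine (existsUnique_congr fun u => ?_).2 key
  unfold IsStepSolution
  refine forall_congr' fun v => ?_
  have e1 : (1 / ℓ) * (∫ x in Ω, (|toFn u x| ^ (alpha p - 2) * toFn u x
      - |toFn uPrev x| ^ (alpha p - 2) * toFn uPrev x) * toFn v x)
      = (∫ x in Ω, 1 / ℓ * inner ℝ (powerFlux (alpha p) (toLpCLM Ω p u x)) (toLpCLM Ω p v x))
        - 1 / ℓ * L₁ (toLpCLM Ω p v) := by
    have hint : ∀ w : SobolevW0 Ω (ENNReal.ofReal p), Integrable (fun x =>
        inner ℝ (powerFlux (alpha p) (toLpCLM Ω p w x)) (toLpCLM Ω p v x))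
        (volume.restrict (Ω : Set Plane)) := fun w =>
      integrable_inner_of_memLp hpp (hpot.memLp_flux hpp (Lp.memLp (toLpCLM Ω p w)))
        (Lp.memLp (toLpCLM Ω p v))
    rw [hL₁, integral_const_mul, ← mul_sub, ← integral_sub (hint u) (hint uPrev)]
    congr 2
    ext x
    rw [← inner_sub_left, hinner]
    rfl
  have e3 : (1 / κ) * (∫ x in Ω, negativePart (toFn u x) * toFn v x)
      = -∫ x in Ω, 1 / κ * inner ℝ (-negativePart (toLpCLM Ω p u x)) (toLpCLM Ω p v x) := by
    rw [integral_const_mul, ← mul_neg, ← integral_neg]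
    congr 2
    ext x
    rw [inner_neg_left, neg_neg, hinner]
    rfl
  have e4 : ∫ x in Ω, extendZero (sourceMean a ℓ n) x * toFn v x = L₂ (toLpCLM Ω p v) := by
    rw [hL₂]
    congr 1
    ext x
    rw [hinner]
    rfl
  have e5 : ((1 / ℓ) • L₁ + L₂) (toLpCLM Ω p v)
      = 1 / ℓ * L₁ (toLpCLM Ω p v) + L₂ (toLpCLM Ω p v) := rfl
  have hcombine : ∀ {s₁ s₂ s₃ s₄ t₁ t₃ y₁ y₂ y : ℝ}, s₁ = t₁ - y₁ → s₃ = -t₃ → s₄ = y₂ →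
      y = y₁ + y₂ → (s₁ + s₂ - s₃ = s₄ ↔ t₁ + s₂ + t₃ = y) := by
    rintro _ s₂ _ _ t₁ t₃ y₁ y₂ _ rfl rfl rfl rfl
    constructor <;> intro h <;> linarith
  exact hcombine e1 e3 e4 e5

/-- Iterating a uniquely solvable recursion. -/
lemma existsUnique_fin_sequence {X : Type*} {N : ℕ} {R : ℕ → X → X → Prop}
    (h : ∀ n < N, ∀ x, ∃! y, R n x y) (x₀ : X) :
    ∃! u : Fin (N + 1) → X, u 0 = x₀ ∧ ∀ n : Fin N, R n (u n.castSucc) (u n.succ) := by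
  -- The successor map is made total, with the default value x for n ≥ N, so that recursion on ℕ
  -- defines the sequence.
  have h' : ∀ n x, ∃ y, n < N → R n x y := fun n x => by
    by_cases hn : n < N
    · obtain ⟨y, hy, -⟩ := h n hn x
      exact ⟨y, fun _ => hy⟩
    · exact ⟨x, fun hn' => absurd hn' hn⟩
  choose F hF using h'
  refine ⟨fun i => Nat.rec x₀ F (i : ℕ), ⟨rfl, fun n => hF n _ n.2⟩, ?_⟩
  rintro v ⟨hv0, hv⟩
  funext i
  induction i using Fin.induction with
  | zero => exact hv0
  | succ i ih => exact (h i i.2 _).unique (hv i) (by rw [ih]; exact hF i _ i.2)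

end StepProblem

end IceSheet

theorem mainTheorem4
    (T : ℝ) (hT : 0 < T)
    (Ω : Opens Plane) (hΩ : IsLipschitzDomain Ω)
    (p : ℝ) (hp : 2.8 ≤ p ∧ p ≤ 5) [Fact (1 ≤ ENNReal.ofReal p)]
    (κ : ℝ) (hκ : 0 < κ)
    (N : ℕ) (hN : 1 ≤ N) (ℓ : ℝ) (hℓ : ℓ = T / N)
    (μ : Plane → ℝ) (hμ : AEStronglyMeasurable μ (volume.restrict (Ω : Set Plane)))
    (μ₁ μ₂ : ℝ) (hμ₁ : 0 < μ₁) (hμ₂ : 0 < μ₂)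
    (hμbd : ∀ x ∈ closure (Ω : Set Plane), μ₁ ≤ μ x ∧ μ x ≤ μ₂)
    (a : ℝ → ContClosure Ω) (ha : MemTimeSobolev (ENNReal.ofReal p) T a) :
    (∀ n < N, ∀ uPrev : SobolevW0 Ω (ENNReal.ofReal p),
      ∃! uNext : SobolevW0 Ω (ENNReal.ofReal p), IsStepSolution κ ℓ μ a n uPrev uNext) ∧
    (∀ u₀ ∈ nonnegCone Ω (ENNReal.ofReal p),
      ∃! u : Fin (N + 1) → SobolevW0 Ω (ENNReal.ofReal p),
        u 0 = u₀ ∧ ∀ n : Fin N, IsStepSolution κ ℓ μ a n (u n.castSucc) (u n.succ)) := by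
  have hℓ0 : 0 < ℓ := by
    rw [hℓ]
    exact div_pos hT (by exact_mod_cast hN)
  have hp2 : 2 < p := by linarith [hp.1]
  have hstep : ∀ n < N, ∀ uPrev : SobolevW0 Ω (ENNReal.ofReal p),
      ∃! uNext : SobolevW0 Ω (ENNReal.ofReal p), IsStepSolution κ ℓ μ a n uPrev uNext :=
    fun n _ uPrev => existsUnique_isStepSolution hΩ.isBounded hp2 hκ hℓ0 hμ hμ₁
      (fun x hx => hμbd x (subset_closure hx)) a n uPrev
  exact ⟨hstep, fun u₀ _ => existsUnique_fin_sequence hstep u₀⟩
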